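/- Let $\Lambda$ be the set of convex, $1$-Lipschitz functions $\ell:[0,1]\to\mathbb R$. For $p_1,\dots,p_T\in[0,1]$ and $\ell_1,\dots,\ell_T\in\Lambda$ define the swap regret $$\mathsf{SR}(p_{1:T};\ell_{1:T})=\sup_{\sigma:[0,1]\to[0,1]}\Big(\sum_{t=1}^T\ell_t(p_t)-\sum_{t=1}^T\ell_t(\sigma(p_t))\Big),$$ where the supremum is over all functions $\sigma$. Consider the following $T$-round game. In each round $t=1,\dots,T$: (1) the predictor chooses a probability distribution $\rho_t$ on $[0,1]$, depending on the transcript $(p_1,\dots,p_{t-1};\ell_1,\dots,\ell_{t-1})$ of the previous rounds; (2) the adversary, who knows the predictor's strategy and the transcript (hence also $\rho_t$) and may randomize, reveals a loss $\ell_t\in\Lambda$; (3) the prediction $p_t$ is drawn from $\rho_t$, that is, conditionally on the past transcript and on $\ell_t$, the distribution of $p_t$ is $\rho_t$. A prediction strategy is a choice of a (measurable) map from transcripts to distributions $\rho_t$ for every round $t$. Theorem. There is an absolute constant $C>0$ such that for every integer $T\ge 2$ there exists a prediction strategy which guarantees, against every such (adaptive, possibly randomized) adversary, $$\mathbb E\big[\mathsf{SR}(p_{1:T};\ell_{1:T})\big]\le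 C\sqrt T\,\log T .$$ -/

import Mathlib

open MeasureTheory ProbabilityTheory

namespace SwapRegret

/-- The `1`-Lipschitz convex losses `ℓ : [0,1] → ℝ`. Convexity is Mathlib's `ConvexOn` on the set
`[0,1] ⊆ ℝ`, for the extension of `ℓ` to `ℝ` (whose values outside `[0,1]` are irrelevant).
The σ-algebra is the one inherited from `unitInterval → ℝ`, generated by the evaluations
`ℓ ↦ ℓ x`; on these (continuous) functions it is the Borel σ-algebra of the uniform norm. -/
abbrev Loss : Type :=
  {ℓ : unitInterval → ℝ // LipschitzWith 1 ℓ ∧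
    ConvexOn ℝ (Set.Icc (0 : ℝ) 1) (Set.IccExtend (zero_le_one' ℝ) ℓ)}

/-- The swap regret
`SR(p_{1:T}; ℓ_{1:T}) = sup_{σ : [0,1] → [0,1]} (∑ₜ ℓₜ(pₜ) - ∑ₜ ℓₜ(σ(pₜ)))`,
over all functions `σ`. The supremum is over a nonempty set of reals bounded above by `T`. -/
noncomputable def swapRegret {T : ℕ} (p : Fin T → unitInterval) (ℓ : Fin T → Loss) : ℝ :=
  ⨆ σ : unitInterval → unitInterval, (∑ t, (ℓ t).1 (p t) - ∑ t, (ℓ t).1 (σ (p t)))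

/-- Transcripts `(p_1, …, p_t; ℓ_1, …, ℓ_t)` of `t` rounds. -/
abbrev History (t : ℕ) : Type := (Fin t → unitInterval) × (Fin t → Loss)

/-- A randomized prediction strategy for `T` rounds: in each round the predictor chooses a
probability distribution on `[0,1]`, as a (measurable) function of the transcript of the previous
rounds. Rounds are numbered `0, …, T - 1`, so that round `t` is preceded by `t` rounds. -/
structure PredictionStrategy (T : ℕ) where
  /-- the distribution `ρ t h` chosen in round `t` after the transcript `h` -/
  ρ : (t : Fin T) → Kernel (History t) unitInterval
  markov : ∀ t, IsMarkovKernel (ρ t)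

/-- The random transcript of the rounds before round `t`. -/
def past {T : ℕ} {Ω : Type*} (p : Fin T → Ω → unitInterval) (ℓ : Fin T → Ω → Loss)
    (t : Fin T) (ω : Ω) : History t :=
  (fun s => p (s.castLE t.isLt.le) ω, fun s => ℓ (s.castLE t.isLt.le) ω)

/-- `(p, ℓ)` is a random play of the `T`-round game in which the predictor uses the strategy `S`
and the adversary is arbitrary (adaptive, possibly randomized, knowing `S`, hence also the
distribution chosen in the current round): in every round `t`, after the loss `ℓ t` has been
fixed, the prediction `p t` is drawn from the distribution `S.ρ t (past p ℓ t)`. That is, the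
conditional distribution of `p t` given the past transcript and `ℓ t` is `S.ρ t (past p ℓ t)`.
Nothing is assumed about how `ℓ t` depends on the past transcript or on further randomness. -/
structure IsPlay {T : ℕ} (S : PredictionStrategy T) {Ω : Type*} [MeasurableSpace Ω]
    (P : Measure Ω) (p : Fin T → Ω → unitInterval) (ℓ : Fin T → Ω → Loss) : Prop where
  measurable_prediction : ∀ t, Measurable (p t)
  measurable_loss : ∀ t, Measurable (ℓ t)
  prediction_law : ∀ t,
    HasCondDistrib (p t) (fun ω => (past p ℓ t ω, ℓ t ω)) ((S.ρ t).prodMkRight Loss) P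

end SwapRegret

/-! Predictions are restricted to midpoints `p` of dyadic intervals ("buckets") of length `h = 2⁻ᵏ ≥
2⁻ⁿ`, with `θ = 1/√T` and `2ⁿ` of order `√T`. Distinct buckets have distinct midpoints, so swap
regret is the sum over buckets of the regret against one fixed alternative `q` each. By convexity
this is at most `|p - q|` times an accumulated difference quotient at `p`, taken at distance `h/2`
when `q` is within `16h`, and at distance `16h` otherwise (`regret_le`).

These four scores per bucket are controlled by the potential `∑ exp(r * total) / r` with `r =
θ/(16h)`. Near scores may drift by `3θ/h` per visit, which costs only `48θ` of regret since `|p - q|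
≤ 16h`; far scores get no drift. The `2ᵏ` buckets of scale `k` start with total potential `64/θ`,
the same at every scale, so the logarithm is just the number of scales.

The potential can be kept from growing: a mixture of losses is again convex and `1`-Lipschitz, and
the coarsest dyadic interval whose endpoints are both `θ`-optimal for it is flat at scale `h` but
steep at scale `16h` (`exists_dyadic_scale`). Predicting its midpoint makes all four exponential
moments at most `1`. The minimax principle `exists_weights_sum_nonpos` turns this response to a
known mixture into one distribution good against every loss. Choosing it from rounded weights makes
the strategy measurable, at a cost of `56θ` per round. -/

namespace SwapRegret

/-! ### Minimax by separation, and an exponential moment bound -/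

/-- A finite minimax principle: if every finite mixture of the payoff vectors `v i` has a
nonpositive coordinate, then a single mixture of the coordinates is nonpositive on all `v i`. -/
theorem exists_weights_sum_nonpos {ι B : Type*} [Fintype B] [Nonempty ι] (v : ι → B → ℝ)
    (h : ∀ (s : Finset ι) (c : ι → ℝ), (∀ i ∈ s, 0 ≤ c i) → ∑ i ∈ s, c i = 1 →
      ∃ b, ∑ i ∈ s, c i * v i b ≤ 0) :
    ∃ ρ : B → ℝ, (∀ b, 0 ≤ ρ b) ∧ ∑ b, ρ b = 1 ∧ ∀ i, ∑ b, ρ b * v i b ≤ 0 := by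
  classical
  let U : Set (B → ℝ) := Set.univ.pi fun _ => Set.Ioi 0
  have hUo : IsOpen U := isOpen_set_pi Set.finite_univ fun _ _ => isOpen_Ioi
  have hUc : Convex ℝ U := convex_pi fun _ _ => convex_Ioi 0
  -- A point of the hull is a finite mixture of payoffs, hence has a nonpositive coordinate and
  -- misses the open positive orthant.
  have hdisj : Disjoint U (convexHull ℝ (Set.range v)) := by
    rw [Set.disjoint_left]
    intro u hu hu'
    rw [convexHull_range_eq_exists_affineCombination] at hu'
    obtain ⟨s, c, hc, hc1, rfl⟩ := hu'
    obtain ⟨b, hb⟩ := h s c hc hc1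
    have hpos := hu b (Set.mem_univ b)
    rw [Finset.affineCombination_eq_linear_combination _ _ _ hc1] at hpos
    simp only [Finset.sum_apply, Pi.smul_apply, smul_eq_mul, Set.mem_Ioi] at hpos
    linarith
  obtain ⟨f, r, hfU, hfV⟩ := geometric_hahn_banach_open hUc hUo (convex_convexHull ℝ _) hdisj
  have hUsmul : ∀ a ∈ U, ∀ t : ℝ, 0 < t → t • a ∈ U := fun a ha t ht b _ => by
    have := ha b (Set.mem_univ b)
    simp only [Set.mem_Ioi, Pi.smul_apply, smul_eq_mul] at this ⊢
    positivity
  -- A linear functional bounded above on a cone is nonpositive there.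
  have hfneg : ∀ a ∈ U, f a ≤ 0 := by
    intro a ha
    by_contra! hpos
    have ht : 0 < (|r| + 1) / f a := by positivity
    have := hfU _ (hUsmul a ha _ ht)
    rw [map_smul, smul_eq_mul, div_mul_cancel₀ _ hpos.ne'] at this
    linarith [le_abs_self r]
  have hone : (fun _ => 1 : B → ℝ) ∈ U := fun b _ => by simp
  have hr : 0 ≤ r := by
    by_contra! hr
    have h1 := hfU _ hone
    have h2 : f (fun _ => 1) < 0 := h1.trans hr
    have := hfU _ (hUsmul _ hone (r / f fun _ => 1) (div_pos_of_neg_of_neg hr h2))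
    rw [map_smul, smul_eq_mul, div_mul_cancel₀ _ h2.ne] at this
    exact lt_irrefl _ this
  let w : B → ℝ := fun b => -f (Pi.single b 1)
  have hw : ∀ b, 0 ≤ w b := by
    intro b
    -- Basis vectors lie only on the boundary of the open orthant, hence the perturbation by `δ`
    -- times the all-ones vector.
    have key : ∀ δ : ℝ, 0 < δ → f (Pi.single b 1) ≤ δ * (-f fun _ => 1) := by
      intro δ hδ
      have hmem : Pi.single b (1 : ℝ) + δ • (fun _ => 1 : B → ℝ) ∈ U := by
        intro b' _
        have : 0 ≤ Pi.single (M := fun _ => ℝ) b 1 b' := by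
          by_cases hb : b' = b
          · subst hb; simp
          · simp [hb]
        simp only [Set.mem_Ioi, Pi.add_apply, Pi.smul_apply, smul_eq_mul, mul_one]
        linarith
      have := hfneg _ hmem
      rw [map_add, map_smul, smul_eq_mul] at this
      linarith
    have hc : 0 ≤ -f fun _ => 1 := neg_nonneg.2 (hfneg _ hone)
    have : f (Pi.single b 1) ≤ 0 := by
      refine le_of_forall_pos_le_add fun ε hε => ?_
      refine (key (ε / ((-f fun _ => 1) + 1)) (by positivity)).trans ?_
      rw [zero_add, div_mul_eq_mul_div, div_le_iff₀ (by positivity)]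
      nlinarith
    simpa [w] using this
  have hfw : ∀ a : B → ℝ, f a = -∑ b, w b * a b := by
    intro a
    conv_lhs => rw [← Finset.univ_sum_single a]
    rw [map_sum, ← Finset.sum_neg_distrib]
    refine Finset.sum_congr rfl fun b _ => ?_
    have : Pi.single b (a b) = a b • Pi.single (M := fun _ => ℝ) b 1 := by
      rw [← Pi.single_smul]; simp
    rw [this, map_smul, smul_eq_mul]
    simp only [w]; ring
  have hv : ∀ i, r ≤ f (v i) := fun i => hfV _ (subset_convexHull ℝ _ ⟨i, rfl⟩)
  have hW : 0 < ∑ b, w b := by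
    refine lt_of_le_of_ne (Finset.sum_nonneg fun b _ => hw b) fun h0 => ?_
    have hz : ∀ b, w b = 0 := fun b =>
      (Finset.sum_eq_zero_iff_of_nonneg fun b _ => hw b).1 h0.symm b (Finset.mem_univ b)
    obtain ⟨i⟩ := ‹Nonempty ι›
    have h1 := hfU _ hone
    have h2 := hv i
    rw [hfw] at h1 h2
    simp only [hz, zero_mul, Finset.sum_const_zero, neg_zero] at h1 h2
    linarith
  refine ⟨fun b => w b / ∑ b, w b, fun b => div_nonneg (hw b) hW.le, ?_, fun i => ?_⟩
  · rw [← Finset.sum_div, div_self hW.ne']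
  · have h1 : ∑ b, w b * v i b ≤ 0 := by
      have := hv i
      rw [hfw] at this
      linarith
    have h2 : ∑ b, w b / (∑ b, w b) * v i b = (∑ b, w b * v i b) / ∑ b, w b := by
      rw [Finset.sum_div]
      exact Finset.sum_congr rfl fun b _ => by ring
    rw [h2]
    exact div_nonpos_of_nonpos_of_nonneg h1 hW.le

/-- A bounded random variable with mean at most `d - a` has exponential moment at most `1`
after the shift by `d`. -/
theorem sum_mul_exp_le_one {ι : Type*} (s : Finset ι) (c u : ι → ℝ) (hc : ∀ i ∈ s, 0 ≤ c i)
    (hc1 : ∑ i ∈ s, c i = 1) (hu : ∀ i ∈ s, |u i| ≤ 1) {a d : ℝ} (ha : 0 ≤ a) (ha1 : a ≤ 1)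
    (hmean : ∑ i ∈ s, c i * u i ≤ d - a) :
    ∑ i ∈ s, c i * Real.exp (a * (u i - d)) ≤ 1 := by
  have hterm : ∀ i ∈ s, c i * Real.exp (a * (u i - d)) ≤
      Real.exp (-(a * d)) * (c i + a * (c i * u i) + c i * a ^ 2) := by
    intro i hi
    have hx : |a * u i| ≤ 1 := by
      rw [abs_mul, abs_of_nonneg ha]
      exact mul_le_one₀ ha1 (abs_nonneg _) (hu i hi)
    have h1 := (abs_le.1 (Real.abs_exp_sub_one_sub_id_le hx)).2
    have h2 : (a * u i) ^ 2 ≤ a ^ 2 := by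
      rw [mul_pow, ← sq_abs (u i)]
      exact mul_le_of_le_one_right (sq_nonneg a) (pow_le_one₀ (abs_nonneg _) (hu i hi))
    have h3 : Real.exp (a * (u i - d)) = Real.exp (-(a * d)) * Real.exp (a * u i) := by
      rw [← Real.exp_add]; ring_nf
    rw [h3, show c i * (Real.exp (-(a * d)) * Real.exp (a * u i)) =
      Real.exp (-(a * d)) * (c i * Real.exp (a * u i)) by ring]
    refine mul_le_mul_of_nonneg_left ?_ (Real.exp_nonneg _)
    calc c i * Real.exp (a * u i) ≤ c i * (1 + a * u i + a ^ 2) :=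
          mul_le_mul_of_nonneg_left (by linarith) (hc i hi)
      _ = _ := by ring
  refine (Finset.sum_le_sum hterm).trans ?_
  rw [← Finset.mul_sum, Finset.sum_add_distrib, Finset.sum_add_distrib, ← Finset.mul_sum,
    ← Finset.sum_mul, hc1]
  -- The slack `a` in the mean pays exactly for the second-order term: `1 + a(d - a) + a² = 1 + ad`.
  have h4 : 1 + a * ∑ i ∈ s, c i * u i + 1 * a ^ 2 ≤ Real.exp (a * d) := by
    have := Real.add_one_le_exp (a * d)
    nlinarith [mul_le_mul_of_nonneg_left hmean ha]
  calc Real.exp (-(a * d)) * (1 + a * ∑ i ∈ s, c i * u i + 1 * a ^ 2)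
      ≤ Real.exp (-(a * d)) * Real.exp (a * d) := mul_le_mul_of_nonneg_left h4 (Real.exp_nonneg _)
    _ = 1 := by rw [← Real.exp_add]; simp

/-! ### Dyadic scales of a convex function -/

theorem exists_dyadic_interval {x : ℝ} (hx : x ∈ Set.Icc (0 : ℝ) 1) (n : ℕ) :
    ∃ i : ℕ, i < 2 ^ n ∧ (i : ℝ) * (1 / 2) ^ n ≤ x ∧ x ≤ (i + 1) * (1 / 2) ^ n := by
  induction n with
  | zero => exact ⟨0, by simp, by simpa using hx.1, by simpa using hx.2⟩
  | succ n ih =>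
    obtain ⟨i, hi, h1, h2⟩ := ih
    have e : ((1 : ℝ) / 2) ^ (n + 1) = (1 / 2) ^ n * (1 / 2) := pow_succ _ _
    rw [e]
    by_cases hm : x ≤ (2 * i + 1) * ((1 / 2) ^ n * (1 / 2))
    · exact ⟨2 * i, by rw [pow_succ]; omega, by push_cast; linarith, by push_cast; linarith⟩
    · refine ⟨2 * i + 1, by rw [pow_succ]; omega, ?_, ?_⟩ <;> push_cast <;>
        push Not at hm <;> linarith

/-- Three-point form of convexity. -/
theorem convexOn_three_point {f : ℝ → ℝ} {s : Set ℝ} (hf : ConvexOn ℝ s f) {x y z : ℝ}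
    (hx : x ∈ s) (hz : z ∈ s) (hxy : x ≤ y) (hyz : y ≤ z) :
    (z - x) * f y ≤ (z - y) * f x + (y - x) * f z := by
  rcases hxy.eq_or_lt with rfl | hxy
  · linarith
  rcases hyz.eq_or_lt with rfl | hyz
  · linarith
  exact hf.secant_mono_aux1 hx hz hxy hyz

/-- A convex `1`-Lipschitz function on `[0,1]` has a dyadic interval, not too short, on which it is
minimal up to `θ`, while it grows by `θ` within sixteen times the length of that interval. -/
theorem exists_dyadic_scale {f : ℝ → ℝ} (hf : ConvexOn ℝ (Set.Icc 0 1) f)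
    (hlip : ∀ x y, |f x - f y| ≤ |x - y|) {θ : ℝ} (hθ : 0 < θ) {n : ℕ} (hn : (1 / 2) ^ n ≤ θ) :
    ∃ k ≤ n, ∃ i : ℕ, i < 2 ^ k ∧ ∀ h p : ℝ, h = (1 / 2) ^ k → p = (i + 1 / 2) * h →
      f (p - h / 2) - f p ≤ θ ∧ f (p + h / 2) - f p ≤ θ ∧
      (p + 16 * h ≤ 1 → θ ≤ f (p + 16 * h) - f p) ∧
      (0 ≤ p - 16 * h → θ ≤ f (p - 16 * h) - f p) := by
  classical
  have hcont : ContinuousOn f (Set.Icc 0 1) := by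
    have : LipschitzWith 1 f := LipschitzWith.of_dist_le_mul fun x y => by
      simpa [Real.dist_eq] using hlip x y
    exact this.continuous.continuousOn
  obtain ⟨m, hm, hmin⟩ := isCompact_Icc.exists_isMinOn ⟨0, by simp⟩ hcont
  have hmin' : ∀ x ∈ Set.Icc (0 : ℝ) 1, f m ≤ f x := fun x hx => hmin hx
  -- `Q k`: some dyadic interval of scale `k` has both endpoints `θ`-optimal. The least such `k` is
  -- used; scale `n` qualifies by the Lipschitz bound.
  let Q : ℕ → Prop := fun k => ∃ i : ℕ, i < 2 ^ k ∧
    f (i * (1 / 2) ^ k) ≤ f m + θ ∧ f ((i + 1) * (1 / 2) ^ k) ≤ f m + θ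
  have hQn : Q n := by
    obtain ⟨i, hi, h1, h2⟩ := exists_dyadic_interval hm n
    refine ⟨i, hi, ?_, ?_⟩
    · have := (abs_le.1 (hlip (i * (1 / 2) ^ n) m)).2
      rw [abs_of_nonpos (by linarith)] at this
      linarith
    · have := (abs_le.1 (hlip ((i + 1) * (1 / 2) ^ n) m)).2
      rw [abs_of_nonneg (by linarith)] at this
      linarith
  have hex : ∃ k, Q k := ⟨n, hQn⟩
  obtain ⟨i, hi, h1, h2⟩ := Nat.find_spec hex
  have hkn : Nat.find hex ≤ n := Nat.find_min' hex hQn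
  have hkmin : ∀ j < Nat.find hex, ¬ Q j := fun j hj => Nat.find_min hex hj
  generalize Nat.find hex = k at *
  refine ⟨k, hkn, i, hi, ?_⟩
  rintro h p hh rfl
  rw [← hh] at h1 h2
  have hh0 : 0 < h := by rw [hh]; positivity
  have hh2 : (2 : ℝ) ^ k * h = 1 := by rw [hh, ← mul_pow]; norm_num
  have hi' : ((i : ℝ) + 1) * h ≤ 1 := by
    have : (i : ℝ) + 1 ≤ 2 ^ k := by exact_mod_cast hi
    exact (mul_le_mul_of_nonneg_right this hh0.le).trans_eq hh2
  have hi0 : 0 ≤ (i : ℝ) * h := by positivity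
  have e1 : ((i : ℝ) + 1 / 2) * h - h / 2 = i * h := by ring
  have e2 : ((i : ℝ) + 1 / 2) * h + h / 2 = (i + 1) * h := by ring
  have hoc : Set.OrdConnected {x | x ∈ Set.Icc (0 : ℝ) 1 ∧ f x ≤ f m + θ} :=
    (hf.convex_le (f m + θ)).ordConnected
  have hmS : m ∈ {x | x ∈ Set.Icc (0 : ℝ) 1 ∧ f x ≤ f m + θ} := ⟨hm, by linarith⟩
  have hmid : ((i : ℝ) + 1 / 2) * h ∈ {x | x ∈ Set.Icc (0 : ℝ) 1 ∧ f x ≤ f m + θ} :=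
    hoc.out (x := i * h) (y := (i + 1) * h) ⟨⟨hi0, by linarith⟩, h1⟩
      ⟨⟨by linarith, hi'⟩, h2⟩ ⟨by linarith, by linarith⟩
  generalize hp : ((i : ℝ) + 1 / 2) * h = p at *
  have hpi : p = i * h + h / 2 := by rw [← hp]; ring
  have hpm := hmin' p hmid.1
  rw [e1, e2]
  refine ⟨by linarith, by linarith, ?_⟩
  -- At scale `0` both growth conditions are vacuous, as `p ± 16 * h` leaves `[0,1]`.
  rcases Nat.eq_zero_or_pos k with rfl | hk
  · simp only [pow_zero] at hh
    have hi0' : i = 0 := by simpa using hi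
    subst hi0' hh
    constructor <;> intro <;> norm_num at hpi <;> linarith
  obtain ⟨k', rfl⟩ : ∃ k', k = k' + 1 := ⟨k - 1, by omega⟩
  -- Minimality of `k`: no interval of the next coarser scale has both endpoints `θ`-optimal.
  have hnot : ∀ j : ℕ, (2 * j + 2 : ℝ) * h ≤ 1 →
      f (2 * j * h) ≤ f m + θ → f ((2 * j + 2) * h) ≤ f m + θ → False := by
    intro j hj hj1 hj2
    have h' : ((1 : ℝ) / 2) ^ k' = 2 * h := by rw [hh, pow_succ]; ring
    refine hkmin k' (by omega) ⟨j, ?_, ?_, ?_⟩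
    · have : ((2 * j + 2 : ℝ)) ≤ 2 ^ (k' + 1) := by
        refine le_of_mul_le_mul_right ?_ hh0
        rw [hh2]; exact hj
      have : 2 * j + 2 ≤ 2 ^ (k' + 1) := by exact_mod_cast this
      rw [pow_succ] at this
      omega
    · rw [h']; convert hj1 using 2; ring
    · rw [h']; convert hj2 using 2; ring
  -- `[p, p + 4h]` contains a whole interval of length `2h` of the coarser grid, so the sublevel set
  -- cannot reach `p + 4h`.
  have hright : p + 4 * h ≤ 1 → f m + θ < f (p + 4 * h) := by
    intro hle
    by_contra! hcon
    obtain ⟨j, hj⟩ : ∃ j : ℕ, 2 * j = i + 1 ∨ 2 * j = i + 2 := ⟨(i + 2) / 2, by omega⟩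
    have hj1 : ((i : ℝ) + 1) ≤ 2 * j := by exact_mod_cast (by omega : i + 1 ≤ 2 * j)
    have hj2 : (2 * j : ℝ) ≤ i + 2 := by exact_mod_cast (by omega : 2 * j ≤ i + 2)
    have b1 := mul_le_mul_of_nonneg_right hj1 hh0.le
    have b2 := mul_le_mul_of_nonneg_right hj2 hh0.le
    have hend : p + 4 * h ∈ {x | x ∈ Set.Icc (0 : ℝ) 1 ∧ f x ≤ f m + θ} :=
      ⟨⟨by linarith, hle⟩, hcon⟩
    exact hnot j (by linarith) (hoc.out hmid hend ⟨by linarith, by linarith⟩).2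
      (hoc.out hmid hend ⟨by linarith, by linarith⟩).2
  have hleft : 0 ≤ p - 4 * h → f m + θ < f (p - 4 * h) := by
    intro hle
    by_contra! hcon
    have hi3 : 3 ≤ i := by
      by_contra! hlt
      have : (i : ℝ) ≤ 2 := by exact_mod_cast (by omega : i ≤ 2)
      have := mul_le_mul_of_nonneg_right this hh0.le
      linarith
    obtain ⟨j, hj⟩ : ∃ j : ℕ, 2 * j + 3 = i ∨ 2 * j + 2 = i := ⟨(i - 2) / 2, by omega⟩
    have hj1 : ((2 * j : ℝ) + 2) ≤ i := by exact_mod_cast (by omega : 2 * j + 2 ≤ i)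
    have hj2 : (i : ℝ) ≤ 2 * j + 3 := by exact_mod_cast (by omega : i ≤ 2 * j + 3)
    have b1 := mul_le_mul_of_nonneg_right hj1 hh0.le
    have b2 := mul_le_mul_of_nonneg_right hj2 hh0.le
    have hend : p - 4 * h ∈ {x | x ∈ Set.Icc (0 : ℝ) 1 ∧ f x ≤ f m + θ} :=
      ⟨⟨hle, by linarith⟩, hcon⟩
    exact hnot j (by linarith) (hoc.out hend hmid ⟨by linarith, by linarith⟩).2
      (hoc.out hend hmid ⟨by linarith, by linarith⟩).2
  have hmr : m ≤ p + 4 * h := by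
    by_contra! hcon
    have := hright (by linarith [hm.2])
    have := (hoc.out hmid hmS ⟨by linarith, hcon.le⟩).2
    linarith
  have hml : p - 4 * h ≤ m := by
    by_contra! hcon
    have := hleft (by linarith [hm.1])
    have := (hoc.out hmS hmid ⟨hcon.le, by linarith⟩).2
    linarith
  -- The minimizer `m` is within `4h` of `p`. Going from `p ± 4h` to `p ± 16h` more than doubles the
  -- distance to `m`, so by convexity the excess over the minimum exceeds `2θ`, of which `f p`
  -- accounts for at most `θ`.
  constructor
  · intro hle
    have hy := hright (by linarith)
    have ht := convexOn_three_point hf hm (z := p + 16 * h) ⟨by linarith, hle⟩ hmr (by linarith)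
    by_contra! hlt
    have hz : f (p + 16 * h) < f m + 2 * θ := by linarith [hmid.2]
    have hp1 : 0 ≤ p + 4 * h - m := by linarith
    have q1 := mul_lt_mul_of_pos_left hy (show 0 < p + 16 * h - m by linarith)
    have q2 := mul_le_mul_of_nonneg_left hz.le hp1
    have q3 := mul_pos (show 0 < p + 16 * h - m - 2 * (p + 4 * h - m) by linarith) hθ
    nlinarith
  · intro hle
    have hy := hleft (by linarith)
    have ht := convexOn_three_point hf (x := p - 16 * h) (z := m) ⟨hle, by linarith⟩ hm
      (by linarith) hml
    by_contra! hlt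
    have hz : f (p - 16 * h) < f m + 2 * θ := by linarith [hmid.2]
    have hp1 : 0 ≤ m - (p - 4 * h) := by linarith
    have q1 := mul_lt_mul_of_pos_left hy (show 0 < m - (p - 16 * h) by linarith)
    have q2 := mul_le_mul_of_nonneg_left hz.le hp1
    have q3 := mul_pos (show 0 < m - (p - 16 * h) - 2 * (m - (p - 4 * h)) by linarith) hθ
    nlinarith

/-! ### Buckets, their scores and the regret inside one bucket -/

/-- The extension of a loss to the real line, constant outside `[0,1]`. -/
noncomputable def Loss.ext (ℓ : Loss) (x : ℝ) : ℝ := Set.IccExtend (zero_le_one' ℝ) ℓ.1 x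

theorem Loss.ext_coe (ℓ : Loss) (x : unitInterval) : ℓ.ext x = ℓ.1 x :=
  Set.IccExtend_val (zero_le_one' ℝ) ℓ.1 x

theorem Loss.abs_ext_sub_le (ℓ : Loss) (x y : ℝ) : |ℓ.ext x - ℓ.ext y| ≤ |x - y| := by
  have h := ℓ.2.1.comp (LipschitzWith.projIcc (zero_le_one' ℝ))
  simpa [Real.dist_eq, Loss.ext, Set.IccExtend] using h.dist_le_mul x y

theorem Loss.convexOn_ext (ℓ : Loss) : ConvexOn ℝ (Set.Icc 0 1) ℓ.ext := ℓ.2.2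

theorem Loss.measurable_ext (x : ℝ) : Measurable fun ℓ : Loss => ℓ.ext x :=
  (measurable_pi_apply (Set.projIcc 0 1 (zero_le_one' ℝ) x)).comp measurable_subtype_coe

instance : Nonempty Loss :=
  ⟨⟨fun _ => 0, LipschitzWith.const' 0, convexOn_const 0 (convex_Icc 0 1)⟩⟩

/-- The dyadic subintervals of `[0,1]` of length `2⁻ᵏ` with `k ≤ n`. -/
abbrev Bucket (n : ℕ) : Type := Σ k : Fin (n + 1), Fin (2 ^ (k : ℕ))

namespace Bucket

variable {n : ℕ} (θ : ℝ) (b : Bucket n)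

/-- The length of a dyadic interval. -/
noncomputable def width : ℝ := (1 / 2) ^ (b.1 : ℕ)

/-- The midpoint of a dyadic interval. -/
noncomputable def center : ℝ := ((b.2 : ℕ) + 1 / 2) * b.width

theorem width_pos : 0 < b.width := by unfold width; positivity

theorem two_pow_mul_width : (2 : ℝ) ^ (b.1 : ℕ) * b.width = 1 := by
  rw [width, ← mul_pow]; norm_num

theorem center_sub_half : 0 ≤ b.center - b.width / 2 := by
  have := b.width_pos
  have : 0 ≤ ((b.2 : ℕ) : ℝ) * b.width := by positivity
  unfold center
  linarith

theorem center_add_half : b.center + b.width / 2 ≤ 1 := by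
  have h : (((b.2 : ℕ) : ℝ) + 1) ≤ 2 ^ (b.1 : ℕ) := by exact_mod_cast b.2.2
  have := mul_le_mul_of_nonneg_right h b.width_pos.le
  rw [b.two_pow_mul_width] at this
  unfold center
  linarith

theorem center_mem : b.center ∈ Set.Icc (0 : ℝ) 1 :=
  ⟨by linarith [b.center_sub_half, b.width_pos], by linarith [b.center_add_half, b.width_pos]⟩

/-- The midpoint of a dyadic interval, as a prediction. -/
noncomputable def point : unitInterval := ⟨b.center, b.center_mem⟩

/-- In units of half its length, a bucket's midpoint is odd; equality across scales differing by `d`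
reads odd times `2 ^ d` equals odd, so `d = 0`. Thus a prediction identifies its bucket. -/
theorem point_injective : Function.Injective (point : Bucket n → unitInterval) := by
  have key : ∀ b c : Bucket n, b.center = c.center → (b.1 : ℕ) ≤ c.1 → b = c := by
    rintro ⟨k, i⟩ ⟨m, j⟩ h hle
    obtain ⟨d, hd⟩ := Nat.exists_eq_add_of_le hle
    simp only [center, width] at h hd hle
    have h1 : (2 * (i : ℕ) + 1) * 2 ^ d = 2 * (j : ℕ) + 1 := by
      have h2 : ((2 * (i : ℕ) + 1 : ℝ)) * 2 ^ d = 2 * (j : ℕ) + 1 := by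
        have e : ((1 : ℝ) / 2) ^ (k : ℕ) * 2 ^ (m : ℕ) = 2 ^ d := by
          rw [hd, pow_add, ← mul_assoc, ← mul_pow]; norm_num
        have e' : ((1 : ℝ) / 2) ^ (m : ℕ) * 2 ^ (m : ℕ) = 1 := by
          rw [← mul_pow]; norm_num
        have h3 := congrArg (fun z : ℝ => 2 * (z * 2 ^ (m : ℕ))) h
        simp only [mul_assoc] at h3
        rw [e, e'] at h3
        linarith
      exact_mod_cast h2
    have hd0 : d = 0 := by
      rcases Nat.eq_zero_or_pos d with h0 | h0
      · exact h0
      · obtain ⟨e, rfl⟩ : ∃ e, d = e + 1 := ⟨d - 1, by omega⟩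
        rw [pow_succ, ← mul_assoc] at h1
        omega
    subst hd0
    have hkm : k = m := Fin.ext (by omega)
    subst hkm
    have hij : i = j := Fin.ext (by simpa using h1)
    rw [hij]
  intro b c h
  have h' : b.center = c.center := congrArg Subtype.val h
  rcases le_total (b.1 : ℕ) c.1 with hle | hle
  · exact key b c h' hle
  · exact (key c b h'.symm hle).symm

/-- Normalized difference quotients of a loss at the midpoint `p` of a dyadic interval of length
`h`: the first two bound `ℓ p - ℓ q` by `|p - q|` times their value on the right and on the left
of `p`, the last two do so beyond `p + 16 h` and `p - 16 h`. -/
noncomputable def score (j : Fin 4) (ℓ : Loss) : ℝ :=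
  ![(ℓ.ext (b.center - b.width / 2) - ℓ.ext b.center) / (b.width / 2),
    (ℓ.ext (b.center + b.width / 2) - ℓ.ext b.center) / (b.width / 2),
    -- The default `-1` applies when no `q` is that far away; it keeps the score bounded by `1` and
    -- its mean below minus the rate.
    if b.center + 16 * b.width ≤ 1 then
      (ℓ.ext b.center - ℓ.ext (b.center + 16 * b.width)) / (16 * b.width) else -1,
    if 0 ≤ b.center - 16 * b.width then
      (ℓ.ext b.center - ℓ.ext (b.center - 16 * b.width)) / (16 * b.width) else -1] j

/-- The amount by which the scores are lowered in the potential. -/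
noncomputable def drift (j : Fin 4) : ℝ :=
  ![3 * (θ / b.width), 3 * (θ / b.width), 0, 0] j

/-- The exponential rate of the potential. -/
noncomputable def rate : ℝ := θ / b.width / 16

/-- The score minus the drift. -/
noncomputable def gain (j : Fin 4) (ℓ : Loss) : ℝ := b.score j ℓ - b.drift θ j

/-- The accumulated gain of a bucket over the rounds in which its midpoint was predicted. -/
noncomputable def total (j : Fin 4) {t : ℕ} (h : History t) : ℝ :=
  ∑ s, if h.1 s = b.point then b.gain θ j (h.2 s) else 0

/-- The exponential weight of a bucket. -/
noncomputable def weight (j : Fin 4) {t : ℕ} (h : History t) : ℝ :=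
  Real.exp (b.rate θ * b.total θ j h)

theorem abs_score_le (j : Fin 4) (ℓ : Loss) : |b.score j ℓ| ≤ 1 := by
  have hw := b.width_pos
  have key : ∀ x y c : ℝ, 0 < c → |x - y| = c → |(ℓ.ext x - ℓ.ext y) / c| ≤ 1 := by
    intro x y c hc hxy
    rw [abs_div, abs_of_pos hc, div_le_one hc, ← hxy]
    exact ℓ.abs_ext_sub_le x y
  fin_cases j
  · refine key _ _ _ (by positivity) ?_
    rw [sub_sub_cancel_left, abs_neg, abs_of_pos (by positivity)]
  · refine key _ _ _ (by positivity) ?_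
    rw [add_sub_cancel_left, abs_of_pos (by positivity)]
  · change |ite _ _ _| ≤ 1
    split_ifs
    · refine key _ _ _ (by positivity) ?_
      rw [sub_add_cancel_left, abs_neg, abs_of_pos (by positivity)]
    · simp
  · change |ite _ _ _| ≤ 1
    split_ifs
    · refine key _ _ _ (by positivity) ?_
      rw [sub_sub_cancel, abs_of_pos (by positivity)]
    · simp

theorem measurable_score (j : Fin 4) : Measurable (b.score j) := by
  have m := Loss.measurable_ext
  fin_cases j
  · exact ((m _).sub (m _)).div_const _
  · exact ((m _).sub (m _)).div_const _
  · change Measurable fun ℓ : Loss => ite _ _ _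
    split_ifs
    · exact ((m _).sub (m _)).div_const _
    · exact measurable_const
  · change Measurable fun ℓ : Loss => ite _ _ _
    split_ifs
    · exact ((m _).sub (m _)).div_const _
    · exact measurable_const

/-- Slopes of a convex function increase: the slope from `p` to `q` is at least the one from `p -
h/2` to `p`. -/
theorem ext_sub_le_right (ℓ : Loss) {q : ℝ} (hq : q ≤ 1) (hpq : b.center ≤ q) :
    ℓ.ext b.center - ℓ.ext q ≤ (q - b.center) * b.score 0 ℓ := by
  have hw := b.width_pos
  have h := convexOn_three_point ℓ.convexOn_ext (x := b.center - b.width / 2) (z := q)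
    ⟨b.center_sub_half, by linarith⟩ ⟨by linarith [b.center_mem.1], hq⟩
    (show b.center - b.width / 2 ≤ b.center by linarith) hpq
  change _ ≤ (q - b.center) *
    ((ℓ.ext (b.center - b.width / 2) - ℓ.ext b.center) / (b.width / 2))
  rw [← mul_div_assoc, le_div_iff₀ (by positivity)]
  linarith

theorem ext_sub_le_left (ℓ : Loss) {q : ℝ} (hq : 0 ≤ q) (hpq : q ≤ b.center) :
    ℓ.ext b.center - ℓ.ext q ≤ (b.center - q) * b.score 1 ℓ := by
  have hw := b.width_pos
  have h := convexOn_three_point ℓ.convexOn_ext (z := b.center + b.width / 2) (x := q)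
    ⟨hq, by linarith [b.center_mem.2]⟩ ⟨by linarith, b.center_add_half⟩
    hpq (show b.center ≤ b.center + b.width / 2 by linarith)
  change _ ≤ (b.center - q) *
    ((ℓ.ext (b.center + b.width / 2) - ℓ.ext b.center) / (b.width / 2))
  rw [← mul_div_assoc, le_div_iff₀ (by positivity)]
  linarith

/-- Here the slope from `p` to `q` is compared with the one from `p` to `p + 16h`, which it
dominates. -/
theorem ext_sub_le_far_right (ℓ : Loss) {q : ℝ} (hq : q ≤ 1) (hpq : b.center + 16 * b.width ≤ q) :
    ℓ.ext b.center - ℓ.ext q ≤ (q - b.center) * b.score 2 ℓ := by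
  have hw := b.width_pos
  have h := convexOn_three_point ℓ.convexOn_ext (z := q)
    b.center_mem ⟨by linarith [b.center_mem.1], hq⟩
    (show b.center ≤ b.center + 16 * b.width by linarith) hpq
  change _ ≤ (q - b.center) * ite _ _ _
  rw [if_pos (by linarith), ← mul_div_assoc, le_div_iff₀ (by positivity)]
  linarith

theorem ext_sub_le_far_left (ℓ : Loss) {q : ℝ} (hq : 0 ≤ q) (hpq : q ≤ b.center - 16 * b.width) :
    ℓ.ext b.center - ℓ.ext q ≤ (b.center - q) * b.score 3 ℓ := by
  have hw := b.width_pos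
  have h := convexOn_three_point ℓ.convexOn_ext (x := q)
    ⟨hq, by linarith [b.center_mem.2]⟩ b.center_mem
    hpq (show b.center - 16 * b.width ≤ b.center by linarith)
  change _ ≤ (b.center - q) * ite _ _ _
  rw [if_pos (by linarith), ← mul_div_assoc, le_div_iff₀ (by positivity)]
  linarith

variable {θ}

theorem rate_pos (hθ : 0 < θ) : 0 < b.rate θ := by
  have := b.width_pos
  unfold rate; positivity

theorem div_width_le (hθ : 0 < θ) (hn : 2 ^ n * θ ≤ 2) : θ / b.width ≤ 2 := by
  rw [div_le_iff₀ b.width_pos]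
  have h1 : (2 : ℝ) ^ (b.1 : ℕ) ≤ 2 ^ n :=
    pow_le_pow_right₀ (by norm_num) (Nat.lt_succ_iff.1 b.1.2)
  have h2 : (2 : ℝ) ^ (b.1 : ℕ) * θ ≤ 2 := (mul_le_mul_of_nonneg_right h1 hθ.le).trans hn
  calc θ = 2 ^ (b.1 : ℕ) * b.width * θ := by rw [b.two_pow_mul_width, one_mul]
    _ = 2 ^ (b.1 : ℕ) * θ * b.width := by ring
    _ ≤ 2 * b.width := mul_le_mul_of_nonneg_right h2 b.width_pos.le

theorem rate_le (hθ : 0 < θ) (hn : 2 ^ n * θ ≤ 2) : b.rate θ ≤ 1 / 8 := by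
  have := b.div_width_le hθ hn
  unfold rate; linarith

theorem drift_nonneg (hθ : 0 < θ) (j : Fin 4) : 0 ≤ b.drift θ j := by
  have := b.width_pos
  have : 0 ≤ 3 * (θ / b.width) := by positivity
  fin_cases j <;> simp [drift] <;> positivity

theorem drift_le (hθ : 0 < θ) (hn : 2 ^ n * θ ≤ 2) (j : Fin 4) : b.drift θ j ≤ 6 := by
  have := b.div_width_le hθ hn
  fin_cases j <;> simp [drift] <;> linarith

theorem abs_gain_le (hθ : 0 < θ) (hn : 2 ^ n * θ ≤ 2) (j : Fin 4) (ℓ : Loss) :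
    |b.gain θ j ℓ| ≤ 7 := by
  have h1 := abs_le.1 (b.abs_score_le j ℓ)
  have h2 := b.drift_le hθ hn j
  have h3 := b.drift_nonneg hθ j
  rw [gain, abs_le]
  constructor <;> linarith

/-- From `|eˣ - 1| ≤ 2|x|` for `|x| ≤ 1`. The bound is uniform in the bucket, which makes rounding
the weights cheap. -/
theorem exp_sub_one_div_rate_le (hθ : 0 < θ) (hn : 2 ^ n * θ ≤ 2) (j : Fin 4) (ℓ : Loss) :
    (Real.exp (b.rate θ * b.gain θ j ℓ) - 1) / b.rate θ ≤ 14 := by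
  have h0 := b.rate_pos hθ
  have h1 := b.rate_le hθ hn
  have h2 := b.abs_gain_le hθ hn j ℓ
  have e : |b.rate θ * b.gain θ j ℓ| = b.rate θ * |b.gain θ j ℓ| := by
    rw [abs_mul, abs_of_pos h0]
  have h3 : b.rate θ * |b.gain θ j ℓ| ≤ b.rate θ * 7 := mul_le_mul_of_nonneg_left h2 h0.le
  have h4 := (le_abs_self _).trans (Real.abs_exp_sub_one_le (x := b.rate θ * b.gain θ j ℓ)
    (by rw [e]; linarith))
  rw [div_le_iff₀ h0]
  rw [e] at h4
  linarith

theorem measurable_total (j : Fin 4) (t : ℕ) :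
    Measurable fun h : History t => b.total θ j h := by
  refine Finset.measurable_sum _ fun s _ => Measurable.ite ?_ ?_ measurable_const
  · exact measurableSet_eq_fun ((measurable_pi_apply s).comp measurable_fst) measurable_const
  · exact ((b.measurable_score j).sub_const _).comp ((measurable_pi_apply s).comp measurable_snd)

theorem measurable_weight (j : Fin 4) (t : ℕ) :
    Measurable fun h : History t => b.weight θ j h :=
  ((b.measurable_total j t).const_mul _).exp

theorem weight_pos (j : Fin 4) {t : ℕ} (h : History t) : 0 < b.weight θ j h := Real.exp_pos _

/-- A crude bound, used only for integrability. -/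
theorem weight_le (hθ : 0 < θ) (hn : 2 ^ n * θ ≤ 2) (j : Fin 4) {t : ℕ} (h : History t) :
    b.weight θ j h ≤ Real.exp (7 * t) := by
  refine Real.exp_le_exp.2 ?_
  have h1 : |b.total θ j h| ≤ 7 * t := by
    refine (Finset.abs_sum_le_sum_abs _ _).trans ?_
    refine (Finset.sum_le_sum (g := fun _ => (7 : ℝ)) fun s _ => ?_).trans (by simp; linarith)
    split_ifs
    · exact b.abs_gain_le hθ hn j _
    · simp
  calc b.rate θ * b.total θ j h ≤ b.rate θ * (7 * t) :=
        mul_le_mul_of_nonneg_left ((le_abs_self _).trans h1) (b.rate_pos hθ).le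
    _ ≤ 1 * (7 * t) := mul_le_mul_of_nonneg_right (by linarith [b.rate_le hθ hn]) (by positivity)
    _ = 7 * t := one_mul _

/-- The total gain is bounded by the normalized weight. -/
theorem mul_total_le (hθ : 0 < θ) (j : Fin 4) {t : ℕ} (h : History t) {a : ℝ} (ha : 0 ≤ a)
    (ha1 : a ≤ 1) : a * b.total θ j h ≤ b.weight θ j h / b.rate θ := by
  have hr := b.rate_pos hθ
  have h1 : b.total θ j h ≤ b.weight θ j h / b.rate θ := by
    rw [le_div_iff₀ hr, weight]
    have := Real.add_one_le_exp (b.rate θ * b.total θ j h)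
    linarith
  have h2 : 0 ≤ b.weight θ j h / b.rate θ := div_nonneg (b.weight_pos j h).le hr.le
  calc a * b.total θ j h ≤ a * (b.weight θ j h / b.rate θ) := mul_le_mul_of_nonneg_left h1 ha
    _ ≤ 1 * (b.weight θ j h / b.rate θ) := mul_le_mul_of_nonneg_right ha1 h2
    _ = _ := one_mul _

/-- The regret collected in one bucket against a fixed alternative. -/
theorem regret_le (hθ : 0 < θ) {t : ℕ} (h : History t) (q : unitInterval) :
    ∑ s, (if h.1 s = b.point then (h.2 s).1 b.point - (h.2 s).1 q else 0) ≤
      ∑ j, b.weight θ j h / b.rate θ + 48 * θ * ∑ s, (if h.1 s = b.point then 1 else 0) := by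
  have hw := b.width_pos
  set N : ℝ := ∑ s, (if h.1 s = b.point then 1 else 0) with hN
  have hN0 : 0 ≤ N := Finset.sum_nonneg fun s _ => by split_ifs <;> simp
  -- The position of `q` selects one score `j`, with `a = |q - p|`; restoring the drift costs `a *
  -- drift` per visit. As `q` is arbitrary, all four weights are kept in the bound.
  have key : ∀ (j : Fin 4) (a : ℝ), 0 ≤ a → a ≤ 1 → a * b.drift θ j ≤ 48 * θ →
      (∀ ℓ : Loss, ℓ.ext b.center - ℓ.ext q ≤ a * b.score j ℓ) →
      ∑ s, (if h.1 s = b.point then (h.2 s).1 b.point - (h.2 s).1 q else 0) ≤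
        ∑ j, b.weight θ j h / b.rate θ + 48 * θ * N := by
    intro j a ha ha1 had hle
    have e : a * b.total θ j h + a * b.drift θ j * N =
        ∑ s, (if h.1 s = b.point then a * b.score j (h.2 s) else 0) := by
      rw [total, hN, Finset.mul_sum, Finset.mul_sum, ← Finset.sum_add_distrib]
      refine Finset.sum_congr rfl fun s _ => ?_
      split_ifs
      · rw [gain]; ring
      · ring
    have h1 : ∑ s, (if h.1 s = b.point then (h.2 s).1 b.point - (h.2 s).1 q else 0) ≤
        a * b.total θ j h + a * b.drift θ j * N := by
      rw [e]
      refine Finset.sum_le_sum fun s _ => ?_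
      split_ifs
      · have := hle (h.2 s)
        rw [Loss.ext_coe] at this
        rw [← Loss.ext_coe (h.2 s) b.point]
        exact this
      · exact le_rfl
    have h2 : b.weight θ j h / b.rate θ ≤ ∑ j, b.weight θ j h / b.rate θ :=
      Finset.single_le_sum (f := fun j => b.weight θ j h / b.rate θ)
        (fun j _ => div_nonneg (b.weight_pos j h).le (b.rate_pos hθ).le) (Finset.mem_univ j)
    have h3 := b.mul_total_le hθ j h ha ha1
    have h4 := mul_le_mul_of_nonneg_right had hN0
    linarith
  have hp := b.center_mem
  have hq0 : (0 : ℝ) ≤ q := q.2.1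
  have hq1 : (q : ℝ) ≤ 1 := q.2.2
  have near : ∀ a : ℝ, a ≤ 16 * b.width → a * (3 * (θ / b.width)) ≤ 48 * θ := by
    intro a ha
    calc a * (3 * (θ / b.width)) ≤ 16 * b.width * (3 * (θ / b.width)) :=
          mul_le_mul_of_nonneg_right ha (by positivity)
      _ = 48 * θ := by field_simp; norm_num
  have far : ∀ a : ℝ, a * 0 ≤ 48 * θ := fun a => by rw [mul_zero]; positivity
  rcases le_total b.center q with hpq | hpq
  · rcases le_total (b.center + 16 * b.width) q with hfar | hnear
    · exact key 2 (q - b.center) (by linarith) (by linarith [hp.1]) (far _)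
        fun ℓ => b.ext_sub_le_far_right ℓ hq1 hfar
    · exact key 0 (q - b.center) (by linarith) (by linarith [hp.1]) (near _ (by linarith))
        fun ℓ => b.ext_sub_le_right ℓ hq1 hpq
  · rcases le_total (q : ℝ) (b.center - 16 * b.width) with hfar | hnear
    · exact key 3 (b.center - q) (by linarith) (by linarith [hp.2]) (far _)
        fun ℓ => b.ext_sub_le_far_left ℓ hq0 hfar
    · exact key 1 (b.center - q) (by linarith) (by linarith [hp.2]) (near _ (by linarith))
        fun ℓ => b.ext_sub_le_left ℓ hq0 hpq

end Bucket

/-! ### Response to a mixture, and the minimax distribution -/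

/-- Every mixture of losses has a bucket in which all mean scores are below the drift. -/
theorem exists_bucket_mean_score_le {n : ℕ} {θ : ℝ} (hθ : 0 < θ) (hn : (1 / 2) ^ n ≤ θ)
    (hn2 : 2 ^ n * θ ≤ 2) (s : Finset Loss) (c : Loss → ℝ) (hc : ∀ ℓ ∈ s, 0 ≤ c ℓ)
    (hc1 : ∑ ℓ ∈ s, c ℓ = 1) :
    ∃ b : Bucket n, ∀ j, ∑ ℓ ∈ s, c ℓ * b.score j ℓ ≤ b.drift θ j - b.rate θ := by
  let f : ℝ → ℝ := fun x => ∑ ℓ ∈ s, c ℓ * ℓ.ext x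
  have hf : ConvexOn ℝ (Set.Icc 0 1) f := by
    refine ⟨convex_Icc 0 1, fun x hx y hy a b ha hb hab => ?_⟩
    simp only [f, smul_eq_mul, Finset.mul_sum, ← Finset.sum_add_distrib]
    refine Finset.sum_le_sum fun ℓ hℓ => ?_
    have := mul_le_mul_of_nonneg_left (ℓ.convexOn_ext.2 hx hy ha hb hab) (hc ℓ hℓ)
    simp only [smul_eq_mul] at this
    linarith
  have hlip : ∀ x y, |f x - f y| ≤ |x - y| := by
    intro x y
    simp only [f, ← Finset.sum_sub_distrib]
    refine (Finset.abs_sum_le_sum_abs _ _).trans ?_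
    calc ∑ ℓ ∈ s, |c ℓ * ℓ.ext x - c ℓ * ℓ.ext y| ≤ ∑ ℓ ∈ s, c ℓ * |x - y| := by
          refine Finset.sum_le_sum fun ℓ hℓ => ?_
          rw [← mul_sub, abs_mul, abs_of_nonneg (hc ℓ hℓ)]
          exact mul_le_mul_of_nonneg_left (ℓ.abs_ext_sub_le x y) (hc ℓ hℓ)
      _ = |x - y| := by rw [← Finset.sum_mul, hc1, one_mul]
  obtain ⟨k, hk, i, hi, H⟩ := exists_dyadic_scale hf hlip hθ hn
  let b : Bucket n := ⟨⟨k, Nat.lt_succ_of_le hk⟩, ⟨i, hi⟩⟩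
  obtain ⟨h1, h2, h3, h4⟩ := H b.width b.center rfl rfl
  have hw := b.width_pos
  have hα : 0 < θ / b.width := by positivity
  have hmean : ∀ x y d : ℝ, ∑ ℓ ∈ s, c ℓ * ((ℓ.ext x - ℓ.ext y) / d) = (f x - f y) / d := by
    intro x y d
    simp only [f, ← Finset.sum_sub_distrib, Finset.sum_div]
    exact Finset.sum_congr rfl fun ℓ _ => by ring
  have hconst : ∑ ℓ ∈ s, c ℓ * (-1 : ℝ) = -1 := by rw [← Finset.sum_mul, hc1, one_mul]
  -- Near means are at most `2θ/h`; drift `3θ/h` leaves room for the rate.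
  have hnear : ∀ z, z ≤ θ → z / (b.width / 2) ≤ 3 * (θ / b.width) - b.rate θ := by
    intro z hz
    have e : z / (b.width / 2) = 2 * (z / b.width) := by field_simp
    have := div_le_div_of_nonneg_right hz hw.le
    rw [e, Bucket.rate]
    linarith
  -- Tight: the factor `16` in the rate is the `16` of the far distance.
  have hfar : ∀ z, z ≤ -θ → z / (16 * b.width) ≤ 0 - b.rate θ := by
    intro z hz
    have e : z / (16 * b.width) = z / b.width / 16 := by field_simp
    have := div_le_div_of_nonneg_right hz hw.le
    rw [neg_div] at this
    rw [e, Bucket.rate]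
    linarith
  have hrate := b.rate_le hθ hn2
  refine ⟨b, fun j => ?_⟩
  fin_cases j
  · exact (hmean _ _ _).trans_le (hnear _ h1)
  · exact (hmean _ _ _).trans_le (hnear _ h2)
  · change ∑ ℓ ∈ s, c ℓ * ite _ _ _ ≤ 0 - b.rate θ
    split_ifs with hif
    · exact (hmean _ _ _).trans_le (hfar _ (by linarith [h3 hif]))
    · rw [hconst]; linarith
  · change ∑ ℓ ∈ s, c ℓ * ite _ _ _ ≤ 0 - b.rate θ
    split_ifs with hif
    · exact (hmean _ _ _).trans_le (hfar _ (by linarith [h4 hif]))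
    · rw [hconst]; linarith

/-- A distribution on the buckets under which, for given nonnegative weights, the potential does
not increase in expectation, whatever the loss. -/
theorem exists_bucket_distribution {n : ℕ} {θ : ℝ} (hθ : 0 < θ) (hn : (1 / 2) ^ n ≤ θ)
    (hn2 : 2 ^ n * θ ≤ 2) (N : Bucket n → Fin 4 → ℕ) :
    ∃ ρ : Bucket n → ℝ, (∀ b, 0 ≤ ρ b) ∧ ∑ b, ρ b = 1 ∧ ∀ ℓ : Loss, ∑ b, ρ b *
      ∑ j, N b j * ((Real.exp (b.rate θ * b.gain θ j ℓ) - 1) / b.rate θ) ≤ 0 := by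
  refine exists_weights_sum_nonpos
    (fun ℓ b => ∑ j, N b j * ((Real.exp (b.rate θ * b.gain θ j ℓ) - 1) / b.rate θ)) ?_
  intro s c hc hc1
  -- This bucket handles all four scores at once, so the nonnegative weights `N` play no role in its
  -- choice.
  obtain ⟨b, hb⟩ := exists_bucket_mean_score_le hθ hn hn2 s c hc hc1
  have hr := b.rate_pos hθ
  refine ⟨b, ?_⟩
  simp only [Finset.mul_sum]
  rw [Finset.sum_comm]
  refine Finset.sum_nonpos fun j _ => ?_
  have h1 := sum_mul_exp_le_one s c (b.score j) hc hc1 (fun ℓ _ => b.abs_score_le j ℓ) hr.le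
    (by linarith [b.rate_le hθ hn2]) (hb j)
  have e : ∑ ℓ ∈ s, c ℓ * (N b j * ((Real.exp (b.rate θ * b.gain θ j ℓ) - 1) / b.rate θ)) =
      N b j / b.rate θ *
        (∑ ℓ ∈ s, c ℓ * Real.exp (b.rate θ * (b.score j ℓ - b.drift θ j)) - ∑ ℓ ∈ s, c ℓ) := by
    rw [← Finset.sum_sub_distrib, Finset.mul_sum]
    refine Finset.sum_congr rfl fun ℓ _ => ?_
    rw [Bucket.gain]; ring
  rw [e, hc1]
  exact mul_nonpos_of_nonneg_of_nonpos (by positivity) (by linarith)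

/-! ### The potential and its relation to swap regret -/

/-- The potential of a transcript. -/
noncomputable def potential (n : ℕ) (θ : ℝ) {t : ℕ} (h : History t) : ℝ :=
  ∑ b : Bucket n, ∑ j, b.weight θ j h / b.rate θ

/-- The increase of the potential in a round with loss `ℓ` and prediction `x`. -/
noncomputable def potentialStep (n : ℕ) (θ : ℝ) {t : ℕ} (h : History t) (ℓ : Loss)
    (x : unitInterval) : ℝ :=
  ∑ b : Bucket n, if x = b.point then
    ∑ j, b.weight θ j h * ((Real.exp (b.rate θ * b.gain θ j ℓ) - 1) / b.rate θ) else 0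

section Deterministic

variable {n : ℕ} {θ : ℝ}

theorem measurable_potential (t : ℕ) : Measurable fun h : History t => potential n θ h :=
  Finset.measurable_sum _ fun b _ => Finset.measurable_sum _ fun j _ =>
    (b.measurable_weight j t).div_const _

theorem measurable_potentialStep (t : ℕ) :
    Measurable fun z : (History t × Loss) × unitInterval => potentialStep n θ z.1.1 z.1.2 z.2 := by
  refine Finset.measurable_sum _ fun b _ => Measurable.ite
    (measurableSet_eq_fun measurable_snd measurable_const) ?_ measurable_const
  refine Finset.measurable_sum _ fun j _ => ?_
  refine ((b.measurable_weight j t).comp (measurable_fst.comp measurable_fst)).mul ?_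
  have h : Measurable fun z : (History t × Loss) × unitInterval => b.gain θ j z.1.2 :=
    ((b.measurable_score j).sub_const _).comp (measurable_snd.comp measurable_fst)
  exact (((h.const_mul _).exp).sub_const 1).div_const _

theorem potential_nonneg (hθ : 0 < θ) {t : ℕ} (h : History t) : 0 ≤ potential n θ h :=
  Finset.sum_nonneg fun b _ => Finset.sum_nonneg fun j _ =>
    div_nonneg (b.weight_pos j h).le (b.rate_pos hθ).le

theorem potential_le (hθ : 0 < θ) (hn : 2 ^ n * θ ≤ 2) {t : ℕ} (h : History t) :
    potential n θ h ≤ ∑ b : Bucket n, ∑ _j : Fin 4, Real.exp (7 * t) / b.rate θ :=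
  Finset.sum_le_sum fun b _ => Finset.sum_le_sum fun j _ =>
    div_le_div_of_nonneg_right (b.weight_le hθ hn j h) (b.rate_pos hθ).le

/-- Scale `k` has `2ᵏ` buckets with `1 / rate = 16 * 2⁻ᵏ / θ` and four scores: `64 / θ` for each of
the `n + 1` scales. -/
theorem potential_zero (h : History 0) : potential n θ h = 64 * (n + 1) / θ := by
  have h1 : ∀ b : Bucket n, ∑ j, b.weight θ j h / b.rate θ = 64 / θ * (1 / 2) ^ (b.1 : ℕ) := by
    intro b
    have h2 : ∀ j, b.weight θ j h = 1 := fun j => by simp [Bucket.weight, Bucket.total]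
    have h3 := b.width_pos
    simp only [h2, Finset.sum_const, Finset.card_univ, Fintype.card_fin, nsmul_eq_mul,
      Bucket.rate]
    rw [← Bucket.width]
    push_cast
    field_simp
    norm_num
  simp only [potential, h1]
  rw [Fintype.sum_sigma]
  have h4 : ∀ k : Fin (n + 1),
      ∑ _i : Fin (2 ^ (k : ℕ)), 64 / θ * (1 / 2 : ℝ) ^ (k : ℕ) = 64 / θ := by
    intro k
    rw [Finset.sum_const, Finset.card_univ, Fintype.card_fin, nsmul_eq_mul]
    push_cast
    rw [mul_left_comm, ← mul_pow]
    norm_num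
  simp only [h4, Finset.sum_const, Finset.card_univ, Fintype.card_fin, nsmul_eq_mul]
  push_cast
  ring

theorem potential_succ {t : ℕ} (h : History (t + 1)) :
    potential n θ h = potential n θ ((fun s => h.1 s.castSucc, fun s => h.2 s.castSucc) : History t)
      + potentialStep n θ ((fun s => h.1 s.castSucc, fun s => h.2 s.castSucc) : History t)
        (h.2 (Fin.last t)) (h.1 (Fin.last t)) := by
  rw [potential, potential, potentialStep, ← Finset.sum_add_distrib]
  refine Finset.sum_congr rfl fun b _ => ?_
  have key : ∀ j, b.total θ j h =
      b.total θ j ((fun s => h.1 s.castSucc, fun s => h.2 s.castSucc) : History t) +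
        if h.1 (Fin.last t) = b.point then b.gain θ j (h.2 (Fin.last t)) else 0 := fun j => by
    rw [Bucket.total, Bucket.total, Fin.sum_univ_castSucc]
  simp only [Bucket.weight, key]
  split_ifs
  · rw [← Finset.sum_add_distrib]
    refine Finset.sum_congr rfl fun j _ => ?_
    rw [mul_add, Real.exp_add]
    ring
  · simp

theorem potentialStep_point {t : ℕ} (h : History t) (ℓ : Loss) (b : Bucket n) :
    potentialStep n θ h ℓ b.point =
      ∑ j, b.weight θ j h * ((Real.exp (b.rate θ * b.gain θ j ℓ) - 1) / b.rate θ) := by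
  rw [potentialStep, Finset.sum_eq_single b]
  · simp
  · intro c _ hc
    rw [if_neg]
    exact fun heq => hc (Bucket.point_injective heq).symm
  · simp

/-- The regret against a swap function, split into the buckets. -/
theorem sum_sub_sum_eq {T : ℕ} {p : Fin T → unitInterval} (ℓ : Fin T → Loss)
    (hp : ∀ t, ∃ b : Bucket n, p t = b.point) (σ : unitInterval → unitInterval) :
    ∑ t, (ℓ t).1 (p t) - ∑ t, (ℓ t).1 (σ (p t)) = ∑ b : Bucket n, ∑ t,
      if p t = b.point then (ℓ t).1 b.point - (ℓ t).1 (σ b.point) else 0 := by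
  rw [Finset.sum_comm, ← Finset.sum_sub_distrib]
  refine Finset.sum_congr rfl fun t _ => ?_
  obtain ⟨b, hb⟩ := hp t
  rw [Finset.sum_eq_single b, if_pos hb, hb]
  · intro c _ hc
    rw [if_neg]
    exact fun heq => hc (Bucket.point_injective (heq.symm.trans hb))
  · simp

theorem swapRegret_le (hθ : 0 < θ) {T : ℕ} {p : Fin T → unitInterval} (ℓ : Fin T → Loss)
    (hp : ∀ t, ∃ b : Bucket n, p t = b.point) :
    swapRegret p ℓ ≤ potential n θ ((p, ℓ) : History T) + 48 * θ * T := by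
  refine ciSup_le fun σ => ?_
  rw [sum_sub_sum_eq ℓ hp σ]
  refine (Finset.sum_le_sum fun b _ => b.regret_le hθ ((p, ℓ) : History T) (σ b.point)).trans ?_
  rw [Finset.sum_add_distrib, ← Finset.mul_sum]
  have h1 : ∑ b : Bucket n, ∑ t, (if p t = b.point then (1 : ℝ) else 0) = T := by
    rw [Finset.sum_comm]
    have : ∀ t, ∑ b : Bucket n, (if p t = b.point then (1 : ℝ) else 0) = 1 := by
      intro t
      obtain ⟨b, hb⟩ := hp t
      rw [Finset.sum_eq_single b, if_pos hb]
      · intro c _ hc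
        rw [if_neg]
        exact fun heq => hc (Bucket.point_injective (heq.symm.trans hb))
      · simp
    simp [this]
  exact (congrArg (fun z => _ + 48 * θ * z) h1).le

/-- For measurability, the uncountable supremum becomes a countable one: only the values of `σ` at
midpoints matter, and the regret is continuous in them. -/
theorem swapRegret_eq_iSup {T : ℕ} {p : Fin T → unitInterval} (ℓ : Fin T → Loss)
    (hp : ∀ t, ∃ b : Bucket n, p t = b.point) :
    swapRegret p ℓ = ⨆ q : Bucket n → ℕ, ∑ b : Bucket n, ∑ t,
      if p t = b.point then
        (ℓ t).1 b.point - (ℓ t).1 (TopologicalSpace.denseSeq unitInterval (q b)) else 0 := by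
  classical
  let F : (Bucket n → unitInterval) → ℝ := fun q => ∑ b : Bucket n, ∑ t,
    if p t = b.point then (ℓ t).1 b.point - (ℓ t).1 (q b) else 0
  have hF : Continuous F := by
    refine continuous_finsetSum _ fun b _ => continuous_finsetSum _ fun t _ => ?_
    split_ifs
    · exact continuous_const.sub ((ℓ t).2.1.continuous.comp (continuous_apply b))
    · exact continuous_const
  have hd : DenseRange (Pi.map fun (_ : Bucket n) => TopologicalSpace.denseSeq unitInterval) :=
    DenseRange.piMap fun _ => TopologicalSpace.denseRange_denseSeq unitInterval
  have h1 : swapRegret p ℓ = ⨆ σ : unitInterval → unitInterval, F fun b => σ b.point := by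
    simp only [swapRegret, F, sum_sub_sum_eq ℓ hp]
  have hsurj : Function.Surjective
      fun (σ : unitInterval → unitInterval) (b : Bucket n) => σ b.point := fun q =>
    ⟨Function.extend Bucket.point q 0, funext fun b =>
      Bucket.point_injective.extend_apply q 0 b⟩
  rw [h1, hsurj.iSup_comp F, ← hd.ciSup' hF]
  exact (Set.rangeFactorization_surjective.iSup_comp
    (g := fun s : Set.range (Pi.map fun (_ : Bucket n) =>
      TopologicalSpace.denseSeq unitInterval) => F s)).symm

theorem swapRegret_nonneg {T : ℕ} (p : Fin T → unitInterval) (ℓ : Fin T → Loss) :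
    0 ≤ swapRegret p ℓ := by
  refine (le_ciSup (f := fun σ : unitInterval → unitInterval =>
    ∑ t, (ℓ t).1 (p t) - ∑ t, (ℓ t).1 (σ (p t))) ⟨T, ?_⟩ id).trans' (by simp)
  rintro _ ⟨σ, rfl⟩
  simp only [← Finset.sum_sub_distrib]
  refine (Finset.sum_le_sum (g := fun _ => (1 : ℝ)) fun t _ => ?_).trans (by simp)
  have h := (ℓ t).2.1.dist_le_mul (p t) (σ (p t))
  rw [Real.dist_eq, NNReal.coe_one, one_mul] at h
  refine (le_abs_self _).trans (h.trans ?_)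
  rw [Subtype.dist_eq, Real.dist_eq, abs_le]
  have a := (p t).2
  have c := (σ (p t)).2
  constructor <;> linarith [a.1, a.2, c.1, c.2]

end Deterministic

/-! ### The randomized strategy and the expected potential -/

/-- The finitely supported distribution with mass `ρ b` on the midpoint of `b`. -/
noncomputable def bucketMeasure {n : ℕ} (ρ : Bucket n → ℝ) : Measure unitInterval :=
  ∑ b, ENNReal.ofReal (ρ b) • Measure.dirac b.point

section BucketMeasure

variable {n : ℕ} {ρ : Bucket n → ℝ}

theorem isProbabilityMeasure_bucketMeasure (h0 : ∀ b, 0 ≤ ρ b) (h1 : ∑ b, ρ b = 1) :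
    IsProbabilityMeasure (bucketMeasure ρ) := by
  constructor
  simp only [bucketMeasure, Measure.coe_finsetSum, Finset.sum_apply, Measure.smul_apply,
    measure_univ, smul_eq_mul, mul_one]
  rw [← ENNReal.ofReal_sum_of_nonneg fun b _ => h0 b, h1, ENNReal.ofReal_one]

theorem integral_bucketMeasure (h0 : ∀ b, 0 ≤ ρ b) (f : unitInterval → ℝ) :
    ∫ x, f x ∂bucketMeasure ρ = ∑ b, ρ b * f b.point := by
  rw [bucketMeasure, integral_finsetSum_measure]
  · refine Finset.sum_congr rfl fun b _ => ?_
    rw [integral_smul_measure, integral_dirac, ENNReal.toReal_ofReal (h0 b), smul_eq_mul]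
  · exact fun b _ => (integrable_dirac (by simp)).smul_measure ENNReal.ofReal_ne_top

theorem ae_bucketMeasure : ∀ᵐ x ∂bucketMeasure ρ, ∃ b : Bucket n, x = b.point := by
  have hm : MeasurableSet {x : unitInterval | ∃ b : Bucket n, x = b.point}ᶜ := by
    refine MeasurableSet.compl ?_
    have : {x : unitInterval | ∃ b : Bucket n, x = b.point} =
        Set.range (Bucket.point (n := n)) := by
      ext x; simp [eq_comm]
    rw [this]
    exact (Set.finite_range _).measurableSet
  rw [ae_iff]
  simp only [bucketMeasure, Measure.coe_finsetSum, Finset.sum_apply, Measure.smul_apply]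
  refine Finset.sum_eq_zero fun b _ => ?_
  have hb : b.point ∉ {x : unitInterval | ∃ b : Bucket n, x = b.point}ᶜ := fun hb => hb ⟨b, rfl⟩
  rw [show {x : unitInterval | ¬∃ b : Bucket n, x = b.point} =
    {x | ∃ b : Bucket n, x = b.point}ᶜ from rfl, Measure.dirac_apply' _ hm,
    Set.indicator_of_notMem hb, smul_zero]

end BucketMeasure

/-- The weights of the buckets, rounded down to integer multiples of `θ`. -/
noncomputable def roundedWeight (n : ℕ) (θ : ℝ) {t : ℕ} (h : History t) :
    Bucket n → Fin 4 → ℕ :=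
  fun b j => ⌊b.weight θ j h / θ⌋₊

theorem measurable_roundedWeight (n : ℕ) (θ : ℝ) (t : ℕ) :
    Measurable fun h : History t => roundedWeight n θ h :=
  measurable_pi_lambda _ fun b => measurable_pi_lambda _ fun j =>
    Nat.measurable_floor.comp ((b.measurable_weight j t).div_const θ)

/-- The strategy that predicts according to a distribution on the buckets which depends on the
rounded weights. -/
noncomputable def bucketStrategy (T n : ℕ) (θ : ℝ) (ρ : (Bucket n → Fin 4 → ℕ) → Bucket n → ℝ)
    (h0 : ∀ N b, 0 ≤ ρ N b) (h1 : ∀ N, ∑ b, ρ N b = 1) : PredictionStrategy T where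
  -- Rounded weights range over a countable discrete space, so an arbitrary choice of `ρ` still
  -- yields a kernel.
  ρ t := (Kernel.ofFunOfCountable fun N => bucketMeasure (ρ N)).comap
    (fun h : History t => roundedWeight n θ h) (measurable_roundedWeight n θ t)
  markov _ := ⟨fun h => isProbabilityMeasure_bucketMeasure (h0 (roundedWeight n θ h))
    (h1 (roundedWeight n θ h))⟩

section Game

variable {T n : ℕ} {θ : ℝ} {ρ : (Bucket n → Fin 4 → ℕ) → Bucket n → ℝ}
  (h0 : ∀ N b, 0 ≤ ρ N b) (h1 : ∀ N, ∑ b, ρ N b = 1)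

/-- Against every loss, the potential grows by at most `56 θ` in expectation. -/
theorem integral_potentialStep_le (hθ : 0 < θ) (hn : 2 ^ n * θ ≤ 2)
    (h2 : ∀ N (ℓ : Loss), ∑ b, ρ N b *
      ∑ j, N b j * ((Real.exp (b.rate θ * b.gain θ j ℓ) - 1) / b.rate θ) ≤ 0)
    (t : Fin T) (h : History t) (ℓ : Loss) :
    ∫ x, potentialStep n θ h ℓ x ∂((bucketStrategy T n θ ρ h0 h1).ρ t h) ≤ 56 * θ := by
  change ∫ x, potentialStep n θ h ℓ x ∂bucketMeasure (ρ (roundedWeight n θ h)) ≤ _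
  rw [integral_bucketMeasure (h0 _)]
  set N := roundedWeight n θ h with hN
  -- Rounding loses at most `θ` per weight, multiplied by an increment of at most `14`, for each of
  -- four scores.
  have hterm : ∀ b : Bucket n, potentialStep n θ h ℓ b.point ≤
      θ * ∑ j, N b j * ((Real.exp (b.rate θ * b.gain θ j ℓ) - 1) / b.rate θ) + 56 * θ := by
    intro b
    rw [potentialStep_point, Finset.mul_sum]
    have hj : ∀ j, b.weight θ j h * ((Real.exp (b.rate θ * b.gain θ j ℓ) - 1) / b.rate θ) ≤
        θ * (N b j * ((Real.exp (b.rate θ * b.gain θ j ℓ) - 1) / b.rate θ)) + 14 * θ := by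
      intro j
      have e := b.exp_sub_one_div_rate_le hθ hn j ℓ
      have hw := b.weight_pos (θ := θ) j h
      have hlo : N b j * θ ≤ b.weight θ j h :=
        (le_div_iff₀ hθ).1 (Nat.floor_le (div_nonneg hw.le hθ.le))
      have hup : b.weight θ j h ≤ (N b j + 1) * θ :=
        (div_le_iff₀ hθ).1 (Nat.lt_floor_add_one _).le
      have hs : (b.weight θ j h - N b j * θ) *
          ((Real.exp (b.rate θ * b.gain θ j ℓ) - 1) / b.rate θ) ≤ θ * 14 :=
        (mul_le_mul_of_nonneg_left e (by linarith)).trans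
          (mul_le_mul_of_nonneg_right (by linarith) (by norm_num))
      linarith
    refine (Finset.sum_le_sum fun j _ => hj j).trans ?_
    rw [Finset.sum_add_distrib]
    simp only [Finset.sum_const, Finset.card_univ, Fintype.card_fin, nsmul_eq_mul]
    push_cast
    linarith
  calc ∑ b, ρ N b * potentialStep n θ h ℓ b.point
      ≤ ∑ b, ρ N b * (θ * ∑ j, N b j *
          ((Real.exp (b.rate θ * b.gain θ j ℓ) - 1) / b.rate θ) + 56 * θ) :=
        Finset.sum_le_sum fun b _ => mul_le_mul_of_nonneg_left (hterm b) (h0 N b)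
    _ = θ * (∑ b, ρ N b * ∑ j, N b j *
          ((Real.exp (b.rate θ * b.gain θ j ℓ) - 1) / b.rate θ)) + (∑ b, ρ N b) * (56 * θ) := by
        rw [Finset.mul_sum, Finset.sum_mul, ← Finset.sum_add_distrib]
        exact Finset.sum_congr rfl fun b _ => by ring
    _ ≤ 56 * θ := by
        rw [h1 N, one_mul]
        have := mul_nonpos_of_nonneg_of_nonpos hθ.le (h2 N ℓ)
        linarith

variable {Ω : Type*} [MeasurableSpace Ω] {P : Measure Ω}
  {p : Fin T → Ω → unitInterval} {ℓ : Fin T → Ω → Loss}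

/-- The transcript of the first `m` rounds. -/
def transcript (p : Fin T → Ω → unitInterval) (ℓ : Fin T → Ω → Loss) {m : ℕ} (hm : m ≤ T)
    (ω : Ω) : History m :=
  (fun s => p (s.castLE hm) ω, fun s => ℓ (s.castLE hm) ω)

theorem measurable_transcript (hp : ∀ t, Measurable (p t)) (hℓ : ∀ t, Measurable (ℓ t)) {m : ℕ}
    (hm : m ≤ T) : Measurable (transcript p ℓ hm) :=
  (measurable_pi_lambda _ fun _ => hp _).prodMk (measurable_pi_lambda _ fun _ => hℓ _)

theorem integrable_potential_transcript [IsProbabilityMeasure P] (hθ : 0 < θ) (hn : 2 ^ n * θ ≤ 2)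
    (hp : ∀ t, Measurable (p t)) (hℓ : ∀ t, Measurable (ℓ t)) {m : ℕ} (hm : m ≤ T) :
    Integrable (fun ω => potential n θ (transcript p ℓ hm ω)) P := by
  refine Integrable.of_bound
    ((measurable_potential m).comp (measurable_transcript hp hℓ hm)).aestronglyMeasurable
    (∑ b : Bucket n, ∑ _j : Fin 4, Real.exp (7 * m) / b.rate θ) (ae_of_all _ fun ω => ?_)
  rw [Real.norm_eq_abs, abs_of_nonneg (potential_nonneg hθ _)]
  exact potential_le hθ hn _

/-- Nonnegativity of `c` covers non-integrable `f`, whose integral is `0` by convention. -/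
theorem integral_le_of_forall_le {α : Type*} [MeasurableSpace α] {μ : Measure α}
    [IsProbabilityMeasure μ] {f : α → ℝ} {c : ℝ} (hc : 0 ≤ c) (hf : ∀ x, f x ≤ c) :
    ∫ x, f x ∂μ ≤ c := by
  by_cases hi : Integrable f μ
  · simpa using integral_mono hi (integrable_const c) hf
  · rwa [integral_undef hi]

theorem integral_potential_le [IsProbabilityMeasure P] (hθ : 0 < θ) (hn : 2 ^ n * θ ≤ 2)
    (h2 : ∀ N (ℓ : Loss), ∑ b, ρ N b *
      ∑ j, N b j * ((Real.exp (b.rate θ * b.gain θ j ℓ) - 1) / b.rate θ) ≤ 0)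
    (hplay : IsPlay (bucketStrategy T n θ ρ h0 h1) P p ℓ) (m : ℕ) (hm : m ≤ T) :
    ∫ ω, potential n θ (transcript p ℓ hm ω) ∂P ≤ 64 * (n + 1) / θ + m * (56 * θ) := by
  have hp := hplay.measurable_prediction
  have hℓ := hplay.measurable_loss
  induction m with
  | zero => simp [potential_zero]
  | succ m ih =>
    have ih := ih (by omega)
    let t : Fin T := ⟨m, by omega⟩
    have := (bucketStrategy T n θ ρ h0 h1).markov t
    let D : (History t × Loss) × unitInterval → ℝ := fun z => potentialStep n θ z.1.1 z.1.2 z.2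
    have hD : Measurable D := measurable_potentialStep _
    have hX : Measurable fun ω => (past p ℓ t ω, ℓ t ω) :=
      (measurable_transcript hp hℓ t.isLt.le).prodMk (hℓ t)
    have hZ : Measurable fun ω => ((past p ℓ t ω, ℓ t ω), p t ω) := hX.prodMk (hp t)
    have hprob : IsProbabilityMeasure (P.map fun ω => (past p ℓ t ω, ℓ t ω)) :=
      Measure.isProbabilityMeasure_map hX.aemeasurable
    have hstep : ∀ ω, potential n θ (transcript p ℓ hm ω) =
        potential n θ (transcript p ℓ (by omega : m ≤ T) ω) +
          D ((past p ℓ t ω, ℓ t ω), p t ω) := fun ω => potential_succ _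
    have hint := integrable_potential_transcript (P := P) hθ hn hp hℓ hm
    have hint' := integrable_potential_transcript (P := P) hθ hn hp hℓ (by omega : m ≤ T)
    have hDint : Integrable (fun ω => D ((past p ℓ t ω, ℓ t ω), p t ω)) P := by
      refine (hint.sub hint').congr (ae_of_all _ fun ω => ?_)
      simp only [Pi.sub_apply, hstep ω]
      ring
    have hlaw := (hplay.prediction_law t).map_eq
    have hDint2 : Integrable D ((P.map fun ω => (past p ℓ t ω, ℓ t ω)) ⊗ₘ
        ((bucketStrategy T n θ ρ h0 h1).ρ t).prodMkRight Loss) := by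
      rw [← hlaw]
      exact (integrable_map_measure hD.aestronglyMeasurable hZ.aemeasurable).2 hDint
    -- Integrating first over `p t` given the past and the current loss reduces to the bound for a
    -- fixed loss; how the adversary chose it is irrelevant.
    have hDle : ∫ ω, D ((past p ℓ t ω, ℓ t ω), p t ω) ∂P ≤ 56 * θ := by
      rw [← integral_map hZ.aemeasurable hD.aestronglyMeasurable, hlaw,
        Measure.integral_compProd hDint2]
      refine integral_le_of_forall_le (by positivity) fun z => ?_
      exact integral_potentialStep_le h0 h1 hθ hn h2 t z.1 z.2
    simp only [hstep]
    rw [integral_add hint' hDint]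
    push_cast
    linarith

theorem ae_exists_bucket (hplay : IsPlay (bucketStrategy T n θ ρ h0 h1) P p ℓ) :
    ∀ᵐ ω ∂P, ∀ t, ∃ b : Bucket n, p t ω = b.point := by
  rw [ae_all_iff]
  intro t
  have := (bucketStrategy T n θ ρ h0 h1).markov t
  have hlaw := hplay.prediction_law t
  have hm : MeasurableSet {z : (History t × Loss) × unitInterval |
      ∃ b : Bucket n, z.2 = b.point} := by
    have : {z : (History t × Loss) × unitInterval | ∃ b : Bucket n, z.2 = b.point} =
        Prod.snd ⁻¹' Set.range (Bucket.point (n := n)) := by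
      ext x; simp [eq_comm]
    rw [this]
    exact measurable_snd (Set.finite_range _).measurableSet
  have h : ∀ᵐ z ∂(P.map fun ω => ((past p ℓ t ω, ℓ t ω), p t ω)),
      ∃ b : Bucket n, z.2 = b.point := by
    rw [hlaw.map_eq]
    exact Measure.ae_compProd_of_ae_ae hm (ae_of_all _ fun z => ae_bucketMeasure)
  exact ae_of_ae_map hlaw.aemeasurable h

/-- Almost surely all predictions are midpoints, and there the countable supremum applies. -/
theorem aestronglyMeasurable_swapRegret (hp : ∀ t, Measurable (p t))
    (hℓ : ∀ t, Measurable (ℓ t)) (hae : ∀ᵐ ω ∂P, ∀ t, ∃ b : Bucket n, p t ω = b.point) :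
    AEStronglyMeasurable (fun ω => swapRegret (fun t => p t ω) (fun t => ℓ t ω)) P := by
  have hev : ∀ t (x : unitInterval), Measurable fun ω => (ℓ t ω).1 x := fun t x =>
    (measurable_pi_apply x).comp (measurable_subtype_coe.comp (hℓ t))
  have hmeas : Measurable fun ω => ⨆ q : Bucket n → ℕ, ∑ b : Bucket n, ∑ t,
      if p t ω = b.point then (ℓ t ω).1 b.point -
        (ℓ t ω).1 (TopologicalSpace.denseSeq unitInterval (q b)) else 0 := by
    refine Measurable.iSup fun q => Finset.measurable_sum _ fun b _ =>
      Finset.measurable_sum _ fun t _ => Measurable.ite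
        (measurableSet_eq_fun (hp t) measurable_const) ((hev t _).sub (hev t _)) measurable_const
  refine hmeas.aestronglyMeasurable.congr ?_
  filter_upwards [hae] with ω hω
  exact (swapRegret_eq_iSup (fun t => ℓ t ω) hω).symm

theorem integrable_swapRegret_and_integral_le [IsProbabilityMeasure P] (hθ : 0 < θ)
    (hn : 2 ^ n * θ ≤ 2)
    (h2 : ∀ N (ℓ : Loss), ∑ b, ρ N b *
      ∑ j, N b j * ((Real.exp (b.rate θ * b.gain θ j ℓ) - 1) / b.rate θ) ≤ 0)
    (hplay : IsPlay (bucketStrategy T n θ ρ h0 h1) P p ℓ) :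
    Integrable (fun ω => swapRegret (fun t => p t ω) (fun t => ℓ t ω)) P ∧
      ∫ ω, swapRegret (fun t => p t ω) (fun t => ℓ t ω) ∂P ≤
        64 * (n + 1) / θ + 104 * θ * T := by
  have hp := hplay.measurable_prediction
  have hℓ := hplay.measurable_loss
  have hae := ae_exists_bucket h0 h1 hplay
  have hint := (integrable_potential_transcript (P := P) hθ hn hp hℓ le_rfl).add
    (integrable_const (48 * θ * T))
  have hle : ∀ᵐ ω ∂P, swapRegret (fun t => p t ω) (fun t => ℓ t ω) ≤
      potential n θ (transcript p ℓ le_rfl ω) + 48 * θ * T := by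
    filter_upwards [hae] with ω hω
    exact swapRegret_le hθ (fun t => ℓ t ω) hω
  have hSR : Integrable (fun ω => swapRegret (fun t => p t ω) (fun t => ℓ t ω)) P := by
    refine hint.mono' (aestronglyMeasurable_swapRegret hp hℓ hae) ?_
    filter_upwards [hle] with ω hω
    rwa [Real.norm_eq_abs, abs_of_nonneg (swapRegret_nonneg _ _)]
  refine ⟨hSR, (integral_mono_ae hSR hint hle).trans ?_⟩
  have h3 := integral_potential_le h0 h1 hθ hn h2 hplay T le_rfl
  rw [integral_add' (integrable_potential_transcript hθ hn hp hℓ le_rfl) (integrable_const _)]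
  simp only [integral_const, probReal_univ, one_smul]
  linarith

end Game

/-! ### Choice of parameters -/

theorem exists_two_pow_near_sqrt {T : ℕ} (hT : 2 ≤ T) : ∃ n : ℕ, √(T : ℝ) ≤ 2 ^ n ∧
    (2 : ℝ) ^ n ≤ 2 * √T ∧ (n + 1 : ℝ) ≤ 4 * Real.log T := by
  have hT' : (2 : ℝ) ≤ T := by exact_mod_cast hT
  have hs : Nat.sqrt T ≠ 0 := by
    rw [Ne, Nat.sqrt_eq_zero]; omega
  have hlow : (2 : ℝ) ^ Nat.log 2 (Nat.sqrt T) ≤ √T := by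
    have : ((2 ^ Nat.log 2 (Nat.sqrt T) : ℕ) : ℝ) ≤ Nat.sqrt T := by
      exact_mod_cast Nat.pow_log_le_self 2 hs
    push_cast at this
    exact this.trans Real.nat_sqrt_le_real_sqrt
  -- The least power of two above `⌊√T⌋`, so that the finest buckets have length between `θ/2` and
  -- `θ` for `θ = 1/√T`.
  refine ⟨Nat.log 2 (Nat.sqrt T) + 1, ?_, ?_, ?_⟩
  · have h1 : Nat.sqrt T + 1 ≤ 2 ^ (Nat.log 2 (Nat.sqrt T) + 1) :=
      Nat.lt_pow_succ_log_self (by norm_num) _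
    have h2 : ((Nat.sqrt T : ℝ) + 1) ≤ 2 ^ (Nat.log 2 (Nat.sqrt T) + 1) := by exact_mod_cast h1
    exact Real.real_sqrt_le_nat_sqrt_succ.trans h2
  · rw [pow_succ]; linarith
  · have h1 := Real.log_le_log (by positivity) hlow
    rw [Real.log_pow, Real.log_sqrt (by positivity)] at h1
    have h2 := Real.log_le_log (by norm_num) hT'
    have h3 := Real.log_two_gt_d9
    push_cast
    have h4 : (0 : ℝ) ≤ Nat.log 2 (Nat.sqrt T) := Nat.cast_nonneg _
    nlinarith

end SwapRegret

theorem mainTheorem3 :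
    ∃ C : ℝ, 0 < C ∧ ∀ T : ℕ, 2 ≤ T →
      ∃ S : SwapRegret.PredictionStrategy T,
        ∀ (Ω : Type*) [MeasurableSpace Ω] (P : Measure Ω) [IsProbabilityMeasure P]
          (p : Fin T → Ω → unitInterval) (ℓ : Fin T → Ω → SwapRegret.Loss),
          SwapRegret.IsPlay S P p ℓ →
            Integrable (fun ω => SwapRegret.swapRegret (fun t => p t ω) (fun t => ℓ t ω)) P ∧
            ∫ ω, SwapRegret.swapRegret (fun t => p t ω) (fun t => ℓ t ω) ∂P
              ≤ C * (Real.sqrt T * Real.log T) := by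
  -- `464 = 64 * 4 + 104 * 2`, from `n + 1 ≤ 4 log T` and `1 ≤ 2 log T`.
  refine ⟨464, by norm_num, fun T hT => ?_⟩
  have hT' : (2 : ℝ) ≤ T := by exact_mod_cast hT
  obtain ⟨n, hn1, hn2, hn3⟩ := SwapRegret.exists_two_pow_near_sqrt hT
  have hsq : 0 < √(T : ℝ) := by positivity
  have hθ : 0 < 1 / √(T : ℝ) := by positivity
  have hn : (1 / 2 : ℝ) ^ n ≤ 1 / √T := by
    rw [div_pow, one_pow]
    exact one_div_le_one_div_of_le hsq hn1
  have hn' : 2 ^ n * (1 / √(T : ℝ)) ≤ 2 := by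
    rw [mul_one_div, div_le_iff₀ hsq]
    exact hn2
  choose ρ h0 h1 h2 using SwapRegret.exists_bucket_distribution hθ hn hn'
  refine ⟨SwapRegret.bucketStrategy T n (1 / √T) ρ h0 h1, fun Ω _ P _ p ℓ hplay => ?_⟩
  obtain ⟨hint, hle⟩ := SwapRegret.integrable_swapRegret_and_integral_le h0 h1 hθ hn' h2 hplay
  refine ⟨hint, hle.trans ?_⟩
  have e1 : 64 * ((n : ℝ) + 1) / (1 / √T) = 64 * (n + 1) * √T := by
    rw [div_div_eq_mul_div, div_one]
  have e2 : 104 * (1 / √(T : ℝ)) * T = 104 * √T := by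
    rw [mul_assoc, one_div_mul_eq_div, Real.div_sqrt]
  have h3 : 1 ≤ 2 * Real.log T := by
    have := Real.log_le_log (by norm_num) hT'
    have := Real.log_two_gt_d9
    linarith
  rw [e1, e2]
  calc 64 * (n + 1) * √T + 104 * √(T : ℝ) = (64 * (n + 1) + 104 * 1) * √T := by ring
    _ ≤ (64 * (4 * Real.log T) + 104 * (2 * Real.log T)) * √T :=
        mul_le_mul_of_nonneg_right (by linarith) hsq.le
    _ = 464 * (√T * Real.log T) := by ring
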